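/- Let $p$ be a prime, let $\nu\ge 1$ be an integer, and let $n\ge 1$ be an integer with $p\nmid n$. Let $\mathbb{F}_{p^\nu}$ be the finite field with $p^\nu$ elements. A cyclic code of length $m\ge 1$ over $\mathbb{F}_{p^\nu}$ is an ideal $C$ of the group algebra $\mathbb{F}_{p^\nu}[\mathbb{Z}/m\mathbb{Z}]$; writing the elements of this algebra as $u=\sum_{g\in\mathbb{Z}/m\mathbb{Z}}u_gY^g$, its Euclidean dual is $C^{\perp}=\{v : \sum_{g}c_gv_g=0 \text{ for all } c\in C\}$, and $C$ is called Euclidean complementary dual if $C\cap C^{\perp}=\{0\}$. For every integer $k\ge 0$, the number of Euclidean complementary dual cyclic codes of length $np^k$ over $\mathbb{F}_{p^\nu}$ equals the number of Euclidean complementary dual cyclic codes of length $n$ over $\mathbb{F}_{p^\nu}$, and this number is $$2^{\sum_{d\mid n}\chi(d,p^\nu)\frac{\Phi(d)}{\mathrm{ord}_d(p^\nu)}+\frac12\sum_{d\mid n}\left(1-\chi(d,p^\nu)\right)\frac{\Phi(d)}{\mathrm{ord}_d(p^\nu)}}.$$ Here the sums run over the positive divisors $d$ of $n$, $\Phi$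 is Euler's totient function, $\mathrm{ord}_d(p^\nu)$ is the multiplicative order of $p^\nu$ modulo $d$, and $\chi(d,p^\nu)=1$ if there is a positive integer $i$ with $d\mid p^{\nu i}+1$, and $\chi(d,p^\nu)=0$ otherwise. -/

import Mathlib

/-- The Euclidean inner product `∑ g, u_g v_g` on the group algebra `F[G]`
(the sum may be restricted to the support of `u`). -/
def euclideanInner {F G : Type*} [Field F] (u v : AddMonoidAlgebra F G) : F :=
  ∑ g ∈ u.coeff.support, u.coeff g * v.coeff g

theorem euclideanInner_eq_sum {F G : Type*} [Field F] [Fintype G]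
    (u v : AddMonoidAlgebra F G) :
    euclideanInner u v = ∑ g : G, u.coeff g * v.coeff g := by
  unfold euclideanInner
  refine Finset.sum_subset (Finset.subset_univ _) fun g _ hg => ?_
  rw [Finsupp.notMem_support_iff.mp hg, zero_mul]

/-- The Euclidean dual of an abelian code, i.e. of an ideal `C` of the group algebra `F[G]`. -/
def euclideanDual {F G : Type*} [Field F] [AddCommGroup G]
    (C : Ideal (AddMonoidAlgebra F G)) : Set (AddMonoidAlgebra F G) :=
  {v | ∀ c ∈ C, euclideanInner c v = 0}

/-- An abelian code `C` in `F[G]` is Euclidean complementary dual if `C ∩ C^⊥ = {0}`. -/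
def IsEuclideanComplementaryDual {F G : Type*} [Field F] [AddCommGroup G]
    (C : Ideal (AddMonoidAlgebra F G)) : Prop :=
  (C : Set (AddMonoidAlgebra F G)) ∩ euclideanDual C = {0}

/-- The number of Euclidean complementary dual cyclic codes of length `m` over `F`; a cyclic code
of length `m` over `F` is an ideal of the group algebra `F[ℤ/mℤ]`. -/
noncomputable def numEuclideanComplementaryDualCyclicCodes (F : Type*) [Field F] (m : ℕ) : ℕ :=
  Set.ncard {C : Ideal (AddMonoidAlgebra F (ZMod m)) | IsEuclideanComplementaryDual C}

open scoped Classical in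
/-- `chiFun d q` is `1` if `d ∣ q ^ i + 1` for some positive integer `i`, and `0` otherwise. -/
noncomputable def chiFun (d q : ℕ) : ℝ :=
  if ∃ i : ℕ, 0 < i ∧ d ∣ q ^ i + 1 then 1 else 0

/-- The multiplicative order of `q` modulo `d`. -/
noncomputable def multOrder (d q : ℕ) : ℕ := orderOf (q : ZMod d)

/-! ### Complementary dual codes and antipode-fixed idempotents -/

section Antipode

variable {F G : Type*} [Field F] [AddCommGroup G]

/-! Write σ for the involution Y^g ↦ Y^(-g) and q for the cardinality of F. The dual of C is σ of
its annihilator, so C ∩ C^⊥ = 0 exactly when C is generated by a σ-fixed idempotent, which C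
determines; it remains to count these idempotents. Raising to the power q^k multiplies exponents by
q^k, so an idempotent e = e^(q^k) of length n p^k is supported on the multiples of p^k, a copy of
ℤ/n. This removes the factor p^k. For q prime to n, the σ-fixed x with x^q = x are the functions on
ℤ/n constant on orbits of q and -1. They form a product of copies of F, one per orbit, hence have
2^(number of orbits) idempotents. An element of additive order d has an orbit of size ord_d(q) if -1
is a power of q mod d, and twice that otherwise; summing the inverse sizes counts the orbits. -/

/-- The involution `Y ^ g ↦ Y ^ (-g)` of the group algebra. -/
noncomputable def antipodeEquiv (F G : Type*) [Field F] [AddCommGroup G] :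
    AddMonoidAlgebra F G ≃ₐ[F] AddMonoidAlgebra F G :=
  AddMonoidAlgebra.domCongr F F (AddEquiv.neg G)

@[simp]
theorem coeff_antipodeEquiv (u : AddMonoidAlgebra F G) (g : G) :
    (antipodeEquiv F G u).coeff g = u.coeff (-g) := by
  simp [antipodeEquiv]

@[simp]
theorem antipodeEquiv_antipodeEquiv (u : AddMonoidAlgebra F G) :
    antipodeEquiv F G (antipodeEquiv F G u) = u := by
  ext g
  simp

@[simp]
theorem antipodeEquiv_single (g : G) (a : F) :
    antipodeEquiv F G (.single g a) = .single (-g) a := by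
  simp [antipodeEquiv]

theorem coeff_mul_antipodeEquiv_zero (u v : AddMonoidAlgebra F G) :
    (u * antipodeEquiv F G v).coeff 0 = euclideanInner u v := by
  rw [AddMonoidAlgebra.coeff_mul_apply_left, Finsupp.sum, euclideanInner]
  simp

/-- The dual of an ideal is the image of its annihilator under the antipode. -/
theorem mem_euclideanDual_iff {C : Ideal (AddMonoidAlgebra F G)} {v : AddMonoidAlgebra F G} :
    v ∈ euclideanDual C ↔ ∀ c ∈ C, c * antipodeEquiv F G v = 0 := by
  refine ⟨fun h c hc => ?_, fun h c hc => ?_⟩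
  · ext g
    -- Translating c by Y^(-g) moves the coefficient of c σ(v) at g to 0.
    have := h _ (C.mul_mem_left (.single (-g) 1) hc)
    rw [← coeff_mul_antipodeEquiv_zero, mul_assoc, AddMonoidAlgebra.coeff_single_mul_apply] at this
    simpa using this
  · rw [← coeff_mul_antipodeEquiv_zero, h c hc]
    simp

variable [Fintype G]

/-- The Euclidean inner product as a bilinear form. -/
noncomputable def euclideanBilin (F G : Type*) [Field F] [AddCommGroup G] [Fintype G] :
    LinearMap.BilinForm F (AddMonoidAlgebra F G) :=
  LinearMap.mk₂ F euclideanInner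
    (fun u v w => by simp [euclideanInner_eq_sum, add_mul, Finset.sum_add_distrib])
    (fun a u v => by simp [euclideanInner_eq_sum, Finset.mul_sum, mul_assoc])
    (fun u v w => by simp [euclideanInner_eq_sum, mul_add, Finset.sum_add_distrib])
    (fun a u v => by simp [euclideanInner_eq_sum, Finset.mul_sum, mul_left_comm])

theorem euclideanBilin_isRefl : (euclideanBilin F G).IsRefl := by
  intro u v h
  simp only [euclideanBilin, LinearMap.mk₂_apply, euclideanInner_eq_sum] at h ⊢
  simpa only [mul_comm] using h

theorem isEuclideanComplementaryDual_iff {C : Ideal (AddMonoidAlgebra F G)} :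
    IsEuclideanComplementaryDual C ↔
      ∃ e, IsIdempotentElem e ∧ antipodeEquiv F G e = e ∧ Ideal.span {e} = C := by
  constructor
  · intro h
    have hinter : ∀ x ∈ C, x ∈ euclideanDual C → x = 0 := fun x h1 h2 => by
      have : x ∈ (C : Set (AddMonoidAlgebra F G)) ∩ euclideanDual C := ⟨h1, h2⟩
      rwa [h] at this
    let W : Submodule F (AddMonoidAlgebra F G) := C.restrictScalars F
    have horth : ∀ x, x ∈ (euclideanBilin F G).orthogonal W ↔ x ∈ euclideanDual C :=
      fun x => Iff.rfl
    have : FiniteDimensional F (AddMonoidAlgebra F G) := by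
      infer_instance
    have hd : Disjoint W ((euclideanBilin F G).orthogonal W) :=
      Submodule.disjoint_def.2 fun x h1 h2 => hinter x h1 ((horth x).1 h2)
    -- In finite dimension, trivial intersection gives a direct sum decomposition; e is the
    -- component of 1 in C.
    have htop := (LinearMap.BilinForm.isCompl_orthogonal_of_restrict_nondegenerate
      euclideanBilin_isRefl (LinearMap.BilinForm.nondegenerate_restrict_of_disjoint_orthogonal _
        euclideanBilin_isRefl hd)).sup_eq_top
    obtain ⟨e, he, f, hf, hef⟩ := Submodule.mem_sup.1
      (htop ▸ Submodule.mem_top : (1 : AddMonoidAlgebra F G) ∈ _)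
    replace he : e ∈ C := he
    rw [horth, mem_euclideanDual_iff] at hf
    obtain rfl : f = 1 - e := eq_sub_of_add_eq' hef
    -- The right-hand side is σ-fixed, so e is too, and then e = e².
    have h1 : e = e * antipodeEquiv F G e := by
      have := hf e he
      rwa [map_sub, map_one, mul_sub, mul_one, sub_eq_zero] at this
    have h2 : antipodeEquiv F G e = e := by
      conv_lhs => rw [h1]
      rw [map_mul, antipodeEquiv_antipodeEquiv, mul_comm, ← h1]
    refine ⟨e, ?_, h2, le_antisymm ((Ideal.span_singleton_le_iff_mem _).2 he) fun c hc => ?_⟩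
    · rw [h2] at h1
      exact h1.symm
    · have hz : c * (1 - e) = 0 := by
        refine hinter _ (C.mul_mem_right _ hc) (mem_euclideanDual_iff.2 fun d hd => ?_)
        rw [map_mul, mul_left_comm, hf d hd, mul_zero]
      rw [mul_sub, mul_one, sub_eq_zero] at hz
      rw [hz]
      exact Ideal.mul_mem_left _ _ (Ideal.mem_span_singleton_self e)
  · rintro ⟨e, he, hs, rfl⟩
    refine Set.eq_singleton_iff_unique_mem.2 ⟨⟨Submodule.zero_mem _, ?_⟩, ?_⟩
    · exact mem_euclideanDual_iff.2 fun c _ => by simp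
    · rintro v ⟨hv, hv'⟩
      obtain ⟨a, rfl⟩ := Ideal.mem_span_singleton'.1 hv
      have := mem_euclideanDual_iff.1 hv' e (Ideal.mem_span_singleton_self e)
      rw [map_mul, hs, mul_left_comm, he.eq] at this
      have h0 := congrArg (antipodeEquiv F G) this
      rwa [map_mul, antipodeEquiv_antipodeEquiv, hs, map_zero] at h0

/-- Euclidean complementary dual codes correspond to the idempotents fixed by the antipode. -/
theorem ncard_isEuclideanComplementaryDual :
    {C : Ideal (AddMonoidAlgebra F G) | IsEuclideanComplementaryDual C}.ncard =
      {e : AddMonoidAlgebra F G | IsIdempotentElem e ∧ antipodeEquiv F G e = e}.ncard := by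
  have : {C : Ideal (AddMonoidAlgebra F G) | IsEuclideanComplementaryDual C} =
      (fun e => Ideal.span {e}) ''
        {e : AddMonoidAlgebra F G | IsIdempotentElem e ∧ antipodeEquiv F G e = e} := by
    ext C
    simp [isEuclideanComplementaryDual_iff, and_assoc]
  rw [this]
  refine Set.InjOn.ncard_image fun e he f hf hef => ?_
  obtain ⟨a, ha⟩ := Ideal.mem_span_singleton'.1
    ((hef ▸ Ideal.mem_span_singleton_self e : e ∈ Ideal.span {f}))
  obtain ⟨b, hb⟩ := Ideal.mem_span_singleton'.1
    ((hef ▸ Ideal.mem_span_singleton_self f : f ∈ Ideal.span {e}))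
  have h1 : e * f = e := by rw [← ha, mul_assoc, hf.1.eq]
  have h2 : e * f = f := by rw [← hb, mul_left_comm, he.1.eq]
  exact h1.symm.trans h2

end Antipode

/-- A finite commutative algebra over a field `F` with `q` elements in which `x ^ q = x` holds
has `2 ^ r` idempotents, where `q ^ r` is its number of elements. -/
theorem card_isIdempotentElem_of_pow_card_eq {F B : Type*} [Field F] [Fintype F] [CommRing B]
    [Algebra F B] [Finite B] (h : ∀ x : B, x ^ Fintype.card F = x) {r : ℕ}
    (hr : Nat.card B = Fintype.card F ^ r) :
    Nat.card {e : B // IsIdempotentElem e} = 2 ^ r := by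
  have hq : 1 < Fintype.card F := Fintype.one_lt_card
  -- If x^k = 0, then x = x^(q^k) vanishes because q^k > k.
  have : IsReduced B := by
    refine ⟨fun x ⟨k, hk⟩ => ?_⟩
    have hpow : ∀ j : ℕ, x ^ Fintype.card F ^ j = x := by
      intro j
      induction j with
      | zero => simp
      | succ j ih => rw [pow_succ, pow_mul, ih, h]
    rw [← hpow k]
    exact pow_eq_zero_of_le (Nat.lt_pow_self hq).le hk
  have : Finite (MaximalSpectrum B) := inferInstance
  let := Fintype.ofFinite (MaximalSpectrum B)
  have hfin : ∀ I : MaximalSpectrum B, Finite (B ⧸ I.asIdeal) := fun I =>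
    Finite.of_surjective _ Ideal.Quotient.mk_surjective
  have hfield : ∀ I : MaximalSpectrum B, Nat.card (B ⧸ I.asIdeal) = Fintype.card F := by
    intro I
    have := hfin I
    let : Field (B ⧸ I.asIdeal) := Ideal.Quotient.field _
    have hle : Nat.card (B ⧸ I.asIdeal) ≤ Fintype.card F := by
      let := Fintype.ofFinite (B ⧸ I.asIdeal)
      classical
      -- Every element of the residue field is a root of X^q - X, so there are at most q; the copy
      -- of F supplies q.
      have hroot : (Finset.univ : Finset (B ⧸ I.asIdeal)).val ≤
          (Polynomial.X ^ Fintype.card F - Polynomial.X : Polynomial (B ⧸ I.asIdeal)).roots := by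
        refine (Multiset.le_iff_subset Finset.univ.nodup).2 fun x _ => ?_
        rw [Polynomial.mem_roots (FiniteField.X_pow_card_sub_X_ne_zero _ hq)]
        obtain ⟨y, rfl⟩ := Ideal.Quotient.mk_surjective x
        simp [← map_pow, h]
      have := (Multiset.card_le_card hroot).trans (Polynomial.card_roots' _)
      rw [FiniteField.X_pow_card_sub_X_natDegree_eq _ hq] at this
      rwa [Nat.card_eq_fintype_card]
    refine hle.antisymm ?_
    rw [← Nat.card_eq_fintype_card]
    exact Nat.card_le_card_of_injective _ (algebraMap F (B ⧸ I.asIdeal)).injective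
  let E := IsArtinianRing.equivPi B
  have hcard : Nat.card (MaximalSpectrum B) = r := by
    have h1 := Nat.card_congr E.toEquiv
    rw [hr, Nat.card_pi, Finset.prod_congr rfl fun I _ => hfield I, Finset.prod_const,
      Finset.card_univ] at h1
    rw [Nat.card_eq_fintype_card]
    exact (Nat.pow_right_injective hq h1).symm
  have e1 : {e : B // IsIdempotentElem e} ≃
      ∀ I : MaximalSpectrum B, {x : B ⧸ I.asIdeal // IsIdempotentElem x} :=
    (E.toEquiv.subtypeEquiv (q := fun f => ∀ I, IsIdempotentElem (f I)) fun x => by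
      simp only [IsIdempotentElem]
      rw [← E.injective.eq_iff, map_mul, funext_iff]
      rfl).trans (Equiv.subtypePiEquivPi (p := fun I x => IsIdempotentElem x))
  have htwo : ∀ I : MaximalSpectrum B,
      Nat.card {x : B ⧸ I.asIdeal // IsIdempotentElem x} = 2 := by
    intro I
    let : Field (B ⧸ I.asIdeal) := Ideal.Quotient.field _
    have : {x : B ⧸ I.asIdeal | IsIdempotentElem x} = {0, 1} := by
      ext x
      simp [IsIdempotentElem.iff_eq_zero_or_one]
    exact (congrArg Set.ncard this).trans (Set.ncard_pair zero_ne_one)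
  rw [Nat.card_congr e1, Nat.card_pi, Finset.prod_congr rfl fun I _ => htwo I, Finset.prod_const,
    Finset.card_univ, ← Nat.card_eq_fintype_card, hcard]

/-! ### Frobenius on the group algebra and reduction to a subgroup -/

section Frobenius

variable {F G : Type*} [Field F] [Fintype F] [AddCommGroup G]

/-- Both sides are F-algebra homomorphisms in x, and they agree on each Y^g. -/
theorem AddMonoidAlgebra.pow_card_pow_eq_mapDomain (x : AddMonoidAlgebra F G) (k : ℕ) :
    x ^ Fintype.card F ^ k = x.mapDomain (Fintype.card F ^ k • ·) := by
  have : (FiniteField.frobeniusAlgHom F (AddMonoidAlgebra F G)) ^ k =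
      AddMonoidAlgebra.mapDomainAlgHom F F (nsmulAddMonoidHom (Fintype.card F ^ k)) := by
    apply AddMonoidAlgebra.algHom_ext
    · intro g
      rw [AlgHom.coe_pow, FiniteField.coe_frobeniusAlgHom, pow_iterate]
      simp [AddMonoidAlgebra.single_pow]
    · ext
  have := DFunLike.congr_fun this x
  rw [AlgHom.coe_pow, FiniteField.coe_frobeniusAlgHom, pow_iterate] at this
  exact this

theorem AddMonoidAlgebra.pow_card_eq_mapDomain (x : AddMonoidAlgebra F G) :
    x ^ Fintype.card F = x.mapDomain (Fintype.card F • ·) := by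
  simpa using x.pow_card_pow_eq_mapDomain 1

/-- If multiplication by a power of `#F` maps `G` into the subgroup `G'`, then all idempotents
of `F[G]` come from `F[G']`. -/
theorem ncard_isIdempotentElem_antipodeEquiv_of_injective {G' : Type*} [AddCommGroup G']
    (j : G' →+ G) (hj : Function.Injective j) (k : ℕ)
    (hk : ∀ g : G, ∃ g', j g' = Fintype.card F ^ k • g) :
    {e : AddMonoidAlgebra F G | IsIdempotentElem e ∧ antipodeEquiv F G e = e}.ncard =
      {e : AddMonoidAlgebra F G' | IsIdempotentElem e ∧ antipodeEquiv F G' e = e}.ncard := by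
  let J := AddMonoidAlgebra.mapDomainAlgHom F F j
  have hJ : Function.Injective J := AddMonoidAlgebra.mapDomain_injective hj
  have hcomm : ∀ x, antipodeEquiv F G (J x) = J (antipodeEquiv F G' x) := by
    intro x
    have : (antipodeEquiv F G).toAlgHom.comp J = J.comp (antipodeEquiv F G').toAlgHom := by
      apply AddMonoidAlgebra.algHom_ext
      · intro g
        simp [J]
      · ext
    exact DFunLike.congr_fun this x
  have hidem : ∀ x, IsIdempotentElem (J x) ↔ IsIdempotentElem x := fun x => by
    rw [IsIdempotentElem, ← map_mul, hJ.eq_iff, IsIdempotentElem]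
  rw [← Set.ncard_image_of_injective _ hJ]
  congr 1
  ext e
  constructor
  · rintro ⟨he, hs⟩
    choose f hf using hk
    -- Multiplication by q^k factors as j ∘ f, and it fixes e since e = e^(q^k). No additivity of f
    -- is needed.
    have : J (e.mapDomain f) = e := by
      rw [← he.pow_eq (n := Fintype.card F ^ k) (by positivity)]
      conv_rhs => rw [AddMonoidAlgebra.pow_card_pow_eq_mapDomain]
      rw [he.pow_eq (n := Fintype.card F ^ k) (by positivity)]
      change (e.mapDomain f).mapDomain j = _
      ext1
      simp only [AddMonoidAlgebra.coeff_mapDomain, ← Finsupp.mapDomain_comp]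
      congr 1
      exact funext hf
    refine ⟨e.mapDomain f, ⟨(hidem _).1 (this.symm ▸ he), hJ ?_⟩, this⟩
    rw [← hcomm, this, hs]
  · rintro ⟨x, ⟨hx, hs⟩, rfl⟩
    exact ⟨(hidem x).2 hx, by rw [hcomm, hs]⟩

end Frobenius

/-! ### The multiples of b inside ℤ/ab -/

section ZModMul

/-- The embedding `ℤ/a → ℤ/ab` given by multiplication by `b`. -/
def ZMod.mulRightHom (a b : ℕ) : ZMod a →+ ZMod (a * b) :=
  ZMod.lift a ⟨(AddMonoidHom.mulRight (b : ZMod (a * b))).comp (Int.castAddHom _), by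
    simp [← Nat.cast_mul]⟩

theorem ZMod.mulRightHom_natCast (a b c : ℕ) :
    ZMod.mulRightHom a b (c : ZMod a) = ((c * b : ℕ) : ZMod (a * b)) := by
  have := ZMod.lift_coe a (⟨(AddMonoidHom.mulRight (b : ZMod (a * b))).comp (Int.castAddHom _), by
    simp [← Nat.cast_mul]⟩ : {f : ℤ →+ ZMod (a * b) // f a = 0}) c
  simpa [ZMod.mulRightHom] using this

theorem ZMod.mulRightHom_injective (a b : ℕ) (hb : b ≠ 0) :
    Function.Injective (ZMod.mulRightHom a b) := by
  refine (ZMod.lift_injective _).2 fun m hm => ?_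
  simp only [AddMonoidHom.comp_apply, AddMonoidHom.mulRight_apply, Int.coe_castAddHom] at hm
  have h : ((m * b : ℤ) : ZMod (a * b)) = 0 := by exact_mod_cast hm
  rw [ZMod.intCast_zmod_eq_zero_iff_dvd] at h ⊢
  push_cast at h
  exact Int.dvd_of_mul_dvd_mul_right (by exact_mod_cast hb) h

end ZModMul

/-! ### Orbits of q and -1 on ℤ/n -/

section CyclotomicClasses

/-- The equivalence relation on `ℤ/n` whose classes are the orbits of `q` and `-1`. -/
def signedCyclotomicSetoid {n : ℕ} (u : ZMod n) (hu : IsOfFinOrder u) : Setoid (ZMod n) where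
  r a b := ∃ i : ℕ, b = u ^ i * a ∨ b = -(u ^ i * a)
  iseqv := by
    refine ⟨fun a => ⟨0, by simp⟩, ?_, ?_⟩
    · rintro a b ⟨i, hi⟩
      have hpos := hu.orderOf_pos
      -- A natural-number exponent representing u^(-i).
      refine ⟨orderOf u * i - i, ?_⟩
      have h : u ^ (orderOf u * i - i) * u ^ i = 1 := by
        rw [← pow_add, Nat.sub_add_cancel (Nat.le_mul_of_pos_left i hpos), pow_mul,
          pow_orderOf_eq_one, one_pow]
      rcases hi with rfl | rfl
      · left; rw [← mul_assoc, h, one_mul]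
      · right; rw [mul_neg, ← mul_assoc, h, one_mul, neg_neg]
    · rintro a b c ⟨i, hi⟩ ⟨j, hj⟩
      refine ⟨j + i, ?_⟩
      rcases hi with rfl | rfl <;> rcases hj with rfl | rfl <;> simp [pow_add, mul_assoc]

theorem ZMod.isOfFinOrder_natCast {n q : ℕ} [NeZero n] (h : q.Coprime n) :
    IsOfFinOrder (q : ZMod n) := by
  rw [← ZMod.coe_unitOfCoprime q h, Units.isOfFinOrder_val]
  exact isOfFinOrder_of_finite _

/-- The set of all `± u ^ i` has `orderOf u` or twice as many elements. -/
theorem ncard_setOf_eq_pow_or_eq_neg_pow {d : ℕ} (u : ZMod d) (hu : IsOfFinOrder u)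
    [Decidable (∃ i : ℕ, 0 < i ∧ u ^ i = -1)] :
    {b : ZMod d | ∃ i : ℕ, b = u ^ i ∨ b = -u ^ i}.ncard =
      if ∃ i : ℕ, 0 < i ∧ u ^ i = -1 then orderOf u else 2 * orderOf u := by
  have hP : (Set.range fun i : ℕ => u ^ i).ncard = orderOf u :=
    (Nat.card_congr (finEquivPowers hu).symm).trans (Nat.card_fin _)
  have hfin : (Set.range fun i : ℕ => u ^ i).Finite := by
    refine Set.finite_of_ncard_pos ?_
    rw [hP]
    exact hu.orderOf_pos
  split_ifs with h
  · obtain ⟨j, -, hj⟩ := h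
    rw [← hP]
    congr 1
    ext b
    constructor
    · rintro ⟨i, rfl | rfl⟩
      · exact ⟨i, rfl⟩
      · exact ⟨i + j, by simp [pow_add, hj]⟩
    · rintro ⟨i, rfl⟩
      exact ⟨i, Or.inl rfl⟩
  · have hunion : {b : ZMod d | ∃ i : ℕ, b = u ^ i ∨ b = -u ^ i} =
        (Set.range fun i : ℕ => u ^ i) ∪ Neg.neg '' (Set.range fun i : ℕ => u ^ i) := by
      ext b
      simp [exists_or, eq_comm (a := b), neg_eq_iff_eq_neg]
    rw [hunion, Set.ncard_union_eq ?_ hfin (hfin.image _),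
      Set.ncard_image_of_injective _ neg_injective, hP, two_mul]
    rw [Set.disjoint_left]
    rintro _ ⟨i, rfl⟩ ⟨_, ⟨j, rfl⟩, hij⟩
    -- From u^i = -u^j, this exponent represents u^(i-j) = -1. The factor j + 1 instead of j keeps
    -- it positive even when i = j = 0.
    refine h ⟨i + (orderOf u * (j + 1) - j), ?_, ?_⟩
    · have := Nat.le_mul_of_pos_left (j + 1) hu.orderOf_pos
      omega
    · have hj : u ^ j * u ^ (orderOf u * (j + 1) - j) = 1 := by
        have := Nat.le_mul_of_pos_left (j + 1) hu.orderOf_pos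
        rw [← pow_add, Nat.add_sub_cancel' (by omega), pow_mul, pow_orderOf_eq_one, one_pow]
      simp only at hij
      rw [pow_add, ← hij, neg_mul, hj]

/-- The class of an element of additive order `d` has the size of the class of `1` in `ℤ/d`. -/
theorem ncard_signedCyclotomicSetoid_class {n q : ℕ} (hq : IsOfFinOrder (q : ZMod n)) (g : ZMod n) :
    {b | signedCyclotomicSetoid (q : ZMod n) hq g b}.ncard =
      {b : ZMod (addOrderOf g) | ∃ i : ℕ, b = (q : ZMod (addOrderOf g)) ^ i ∨
        b = -(q : ZMod (addOrderOf g)) ^ i}.ncard := by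
  -- The embedding 1 ↦ g commutes with multiplication by q and -1, so it carries the orbit of 1 onto
  -- the class of g.
  let ψ : ZMod (addOrderOf g) →+ ZMod n :=
    ZMod.lift (addOrderOf g) ⟨zmultiplesHom _ g, by simp [← nsmul_eq_mul, addOrderOf_nsmul_eq_zero]⟩
  have hψ : Function.Injective ψ := by
    refine (ZMod.lift_injective _).2 fun m hm => ?_
    rw [ZMod.intCast_zmod_eq_zero_iff_dvd]
    exact addOrderOf_dvd_iff_zsmul_eq_zero.2 hm
  have hpow : ∀ i : ℕ, ψ ((q : ZMod (addOrderOf g)) ^ i) = (q : ZMod n) ^ i * g := by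
    intro i
    have := ZMod.lift_coe (addOrderOf g) (⟨zmultiplesHom _ g, by
      simp [← nsmul_eq_mul, addOrderOf_nsmul_eq_zero]⟩ : {f : ℤ →+ ZMod n // f (addOrderOf g) = 0}) ((q ^ i : ℕ) : ℤ)
    simpa [ψ] using this
  rw [← Set.ncard_image_of_injective _ hψ]
  congr 1
  ext b
  constructor
  · rintro ⟨i, rfl | rfl⟩
    · exact ⟨_, ⟨i, Or.inl rfl⟩, hpow i⟩
    · exact ⟨_, ⟨i, Or.inr rfl⟩, by rw [map_neg, hpow]⟩
  · rintro ⟨_, ⟨i, rfl | rfl⟩, rfl⟩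
    · exact ⟨i, Or.inl (hpow i)⟩
    · exact ⟨i, Or.inr (by rw [map_neg, hpow])⟩

/-- Each class contributes its size times the inverse of its size, that is 1. -/
theorem Setoid.card_quotient_eq_sum_inv {α : Type*} [Fintype α] (s : Setoid α) :
    (Nat.card (Quotient s) : ℝ) = ∑ a : α, (({b | s a b}.ncard : ℕ) : ℝ)⁻¹ := by
  classical
  rw [Nat.card_eq_fintype_card, ← Finset.sum_fiberwise Finset.univ (Quotient.mk s),
    Finset.sum_congr rfl (g := fun _ => (1 : ℝ))]
  · simp
  · intro c _
    induction c using Quotient.inductionOn with | h a => ?_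
    have hs : ∀ b ∈ Finset.univ.filter (Quotient.mk s · = Quotient.mk s a),
        {x | s b x}.ncard = (Finset.univ.filter (Quotient.mk s · = Quotient.mk s a)).card := by
      intro b hb
      rw [← Set.ncard_coe_finset]
      congr 1
      ext x
      simp only [Finset.coe_filter, Finset.mem_univ, true_and, Set.mem_ofPred_eq,
        Finset.mem_filter] at hb ⊢
      rw [← hb, eq_comm, Quotient.eq]
    rw [Finset.sum_congr rfl fun b hb => by rw [hs b hb], Finset.sum_const, nsmul_eq_mul]
    refine mul_inv_cancel₀ ?_
    exact_mod_cast (Finset.card_pos.2 ⟨a, by simp⟩).ne'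

theorem ZMod.sum_addOrderOf {n : ℕ} [NeZero n] (f : ℕ → ℝ) :
    ∑ g : ZMod n, f (addOrderOf g) = ∑ d ∈ n.divisors, (d.totient : ℝ) * f d := by
  rw [← Finset.sum_fiberwise_of_maps_to (t := n.divisors) (g := fun g : ZMod n => addOrderOf g)]
  · refine Finset.sum_congr rfl fun d hd => ?_
    rw [Finset.sum_congr rfl fun g hg => by rw [(Finset.mem_filter.1 hg).2], Finset.sum_const,
      nsmul_eq_mul, IsAddCyclic.card_addOrderOf_eq_totient]
    rw [ZMod.card]
    exact Nat.dvd_of_mem_divisors hd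
  · intro g _
    rw [Nat.mem_divisors]
    refine ⟨?_, NeZero.ne n⟩
    simpa [ZMod.card] using addOrderOf_dvd_card (x := g)

theorem card_quotient_signedCyclotomicSetoid {n q : ℕ} [NeZero n] (h : q.Coprime n) :
    (Nat.card (Quotient (signedCyclotomicSetoid (q : ZMod n) (ZMod.isOfFinOrder_natCast h))) : ℝ) =
      (∑ d ∈ n.divisors, chiFun d q * ((d.totient : ℝ) / (multOrder d q : ℝ))) +
        (1 / 2 : ℝ) * ∑ d ∈ n.divisors,
          (1 - chiFun d q) * ((d.totient : ℝ) / (multOrder d q : ℝ)) := by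
  classical
  rw [Setoid.card_quotient_eq_sum_inv]
  simp_rw [ncard_signedCyclotomicSetoid_class]
  rw [ZMod.sum_addOrderOf (fun d =>
    (({b : ZMod d | ∃ i : ℕ, b = (q : ZMod d) ^ i ∨ b = -(q : ZMod d) ^ i}.ncard : ℕ) : ℝ)⁻¹),
    Finset.mul_sum, ← Finset.sum_add_distrib]
  refine Finset.sum_congr rfl fun d hd => ?_
  have hdn := Nat.dvd_of_mem_divisors hd
  have : NeZero d := ⟨(Nat.pos_of_mem_divisors hd).ne'⟩
  rw [ncard_setOf_eq_pow_or_eq_neg_pow _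
    (ZMod.isOfFinOrder_natCast (h.coprime_dvd_right hdn))]
  have hchi : (∃ i : ℕ, 0 < i ∧ (q : ZMod d) ^ i = -1) ↔ ∃ i : ℕ, 0 < i ∧ d ∣ q ^ i + 1 := by
    refine exists_congr fun i => and_congr_right fun _ => ?_
    rw [← ZMod.natCast_eq_zero_iff, eq_neg_iff_add_eq_zero]
    push_cast
    rfl
  simp only [hchi, chiFun, multOrder]
  split_ifs <;> push_cast <;> ring

end CyclotomicClasses

/-! ### Counting the fixed idempotents -/

section Count

variable {F : Type*} [Field F] [Fintype F] {n : ℕ} [NeZero n]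

/-- As q is a unit mod n, the coefficient of x^q at qg is that of x at g. The two equations thus say
that the coefficients are invariant under g ↦ qg and g ↦ -g. -/
theorem pow_card_eq_self_and_antipodeEquiv_eq_self_iff (h : (Fintype.card F).Coprime n)
    (x : AddMonoidAlgebra F (ZMod n)) :
    x ^ Fintype.card F = x ∧ antipodeEquiv F (ZMod n) x = x ↔
      signedCyclotomicSetoid (Fintype.card F : ZMod n) (ZMod.isOfFinOrder_natCast h) ≤
        Setoid.ker x.coeff := by
  have hu : IsUnit (Fintype.card F : ZMod n) := (ZMod.isUnit_iff_coprime _ _).2 h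
  have hcoeff : ∀ g, (x ^ Fintype.card F).coeff ((Fintype.card F : ZMod n) * g) = x.coeff g := by
    intro g
    have hinj : Function.Injective (Fintype.card F • · : ZMod n → ZMod n) := by
      intro a b hab
      simp only [nsmul_eq_mul] at hab
      exact hu.mul_left_cancel hab
    rw [AddMonoidAlgebra.pow_card_eq_mapDomain, AddMonoidAlgebra.coeff_mapDomain, ← nsmul_eq_mul]
    exact Finsupp.mapDomain_apply hinj _ _
  constructor
  · rintro ⟨h1, h2⟩ a b ⟨i, hi⟩
    have hneg : ∀ g, x.coeff (-g) = x.coeff g := fun g => by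
      rw [← coeff_antipodeEquiv, h2]
    have hpow : ∀ (i : ℕ) g, x.coeff ((Fintype.card F : ZMod n) ^ i * g) = x.coeff g := by
      intro i
      induction i with
      | zero => simp
      | succ i ih =>
        intro g
        rw [pow_succ, mul_assoc, ih]
        conv_lhs => rw [← h1]
        exact hcoeff g
    rw [Setoid.ker_def]
    rcases hi with rfl | rfl
    · rw [hpow]
    · rw [hneg, hpow]
  · intro hle
    constructor
    · ext g
      obtain ⟨a, rfl⟩ : ∃ a, g = (Fintype.card F : ZMod n) * a :=
        ⟨hu.unit⁻¹ * g, by rw [← mul_assoc, IsUnit.mul_val_inv, one_mul]⟩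
      rw [hcoeff]
      exact hle ⟨1, Or.inl (by rw [pow_one])⟩
    · ext g
      rw [coeff_antipodeEquiv]
      exact (hle ⟨0, Or.inr (by rw [pow_zero, one_mul])⟩ : x.coeff g = x.coeff (-g)).symm

/-- The number of antipode-fixed idempotents is a power of two, with one factor for each class. -/
theorem ncard_isIdempotentElem_antipodeEquiv (h : (Fintype.card F).Coprime n) :
    {e : AddMonoidAlgebra F (ZMod n) |
        IsIdempotentElem e ∧ antipodeEquiv F (ZMod n) e = e}.ncard =
      2 ^ Nat.card (Quotient (signedCyclotomicSetoid (Fintype.card F : ZMod n)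
        (ZMod.isOfFinOrder_natCast h))) := by
  let A := AddMonoidAlgebra F (ZMod n)
  -- All σ-fixed idempotents of A lie in B, since e^q = e, so counting idempotents of B suffices.
  let B : Subalgebra F A := AlgHom.equalizer (FiniteField.frobeniusAlgHom F A) (AlgHom.id F A) ⊓
    AlgHom.equalizer (antipodeEquiv F (ZMod n)).toAlgHom (AlgHom.id F A)
  have hB : ∀ x : A, x ∈ B ↔ x ^ Fintype.card F = x ∧ antipodeEquiv F (ZMod n) x = x :=
    fun x => Iff.rfl
  have : Finite A := (AddMonoidAlgebra.coeffEquiv.trans Finsupp.equivFunOnFinite).finite_iff.2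
    inferInstance
  have hcard : Nat.card B = Fintype.card F ^ Nat.card (Quotient (signedCyclotomicSetoid
      (Fintype.card F : ZMod n) (ZMod.isOfFinOrder_natCast h))) := by
    have e : B ≃ (Quotient (signedCyclotomicSetoid
        (Fintype.card F : ZMod n) (ZMod.isOfFinOrder_natCast h)) → F) :=
      ((AddMonoidAlgebra.coeffEquiv.trans Finsupp.equivFunOnFinite).subtypeEquiv fun x => by
        rw [hB, pow_card_eq_self_and_antipodeEquiv_eq_self_iff h]
        rfl).trans (Setoid.liftEquiv _)
    rw [Nat.card_congr e, Nat.card_fun, Nat.card_eq_fintype_card (α := F)]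
  rw [← card_isIdempotentElem_of_pow_card_eq (F := F) (B := B)
    (fun x => Subtype.ext ((hB x).1 x.2).1) hcard]
  refine Nat.card_congr ⟨fun e => ⟨⟨e.1, (hB _).2 ⟨e.2.1.pow_eq Fintype.card_ne_zero, e.2.2⟩⟩,
    Subtype.ext e.2.1⟩, fun e => ⟨e.1.1, congrArg Subtype.val e.2, ((hB _).1 e.1.2).2⟩,
    fun _ => rfl, fun _ => rfl⟩

end Count

theorem mainTheorem7 (p : ℕ) (hp : p.Prime) (ν : ℕ) (hν : 0 < ν)
    (F : Type*) [Field F] [Fintype F] (hF : Fintype.card F = p ^ ν)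
    (n : ℕ) (hn : 0 < n) (hpn : ¬ p ∣ n) :
    (∀ k : ℕ, numEuclideanComplementaryDualCyclicCodes F (n * p ^ k) =
      numEuclideanComplementaryDualCyclicCodes F n) ∧
    (numEuclideanComplementaryDualCyclicCodes F n : ℝ) =
      (2 : ℝ) ^ ((∑ d ∈ n.divisors,
          chiFun d (p ^ ν) * ((Nat.totient d : ℝ) / (multOrder d (p ^ ν) : ℝ))) +
        (1 / 2 : ℝ) * ∑ d ∈ n.divisors,
          (1 - chiFun d (p ^ ν)) * ((Nat.totient d : ℝ) / (multOrder d (p ^ ν) : ℝ))) := by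
  have : NeZero n := ⟨hn.ne'⟩
  constructor
  · intro k
    have : NeZero (n * p ^ k) := ⟨mul_ne_zero hn.ne' (pow_ne_zero _ hp.ne_zero)⟩
    rw [numEuclideanComplementaryDualCyclicCodes, numEuclideanComplementaryDualCyclicCodes,
      ncard_isEuclideanComplementaryDual, ncard_isEuclideanComplementaryDual]
    refine ncard_isIdempotentElem_antipodeEquiv_of_injective (ZMod.mulRightHom n (p ^ k))
      (ZMod.mulRightHom_injective _ _ (pow_ne_zero _ hp.ne_zero)) k fun g => ?_
    obtain ⟨c, hc⟩ : p ^ k ∣ Fintype.card F ^ k := by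
      rw [hF]
      exact pow_dvd_pow_of_dvd (dvd_pow_self p hν.ne') k
    -- With q^k = p^k c, the multiple q^k g is p^k times gc.
    refine ⟨((g.val * c : ℕ) : ZMod n), ?_⟩
    rw [ZMod.mulRightHom_natCast, hc, nsmul_eq_mul]
    conv_rhs => rw [← ZMod.natCast_zmod_val g]
    push_cast
    ring
  · have hcop : (Fintype.card F).Coprime n := by
      rw [hF]
      exact Nat.Coprime.pow_left _ ((Nat.Prime.coprime_iff_not_dvd hp).2 hpn)
    rw [numEuclideanComplementaryDualCyclicCodes, ncard_isEuclideanComplementaryDual,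
      ncard_isIdempotentElem_antipodeEquiv hcop, ← hF,
      ← card_quotient_signedCyclotomicSetoid hcop, Real.rpow_natCast]
    push_cast
    rfl
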